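/- For a nonempty topological space $X$ let $a$, $b$, $i$, $f$ denote the operators on subsets of $X$ that send $A$ to its complement $X\setminus A$, closure, interior and boundary; write products as compositions, so that $fbiA=f(b(i(A)))$, let $\mathsf{id}$ be the identity operator and let $0A=\varnothing$. Let $\mathrm{KF}^0$ be the set of the $17$ operator symbols $$\mathsf{id},\ b,\ i,\ bi,\ ib,\ bib,\ ibi,\ 0,\ f,\ if,\ fif,\ bif,\ ff,\ fb,\ fi,\ fbi,\ fib,$$ and let $\mathrm{KF}=\mathrm{KF}^0\cup a\,\mathrm{KF}^0$ ($34$ symbols, where $a\,\mathrm{KF}^0=\{ao:o\in\mathrm{KF}^0\}$). A set $C$ of unordered pairs $\{o_1,o_2\}$ with $o_1,o_2\in\mathrm{KF}$ (where $o_1=o_2$ is allowed) is a \emph{local collapse} of $\mathrm{KF}$ if there are a nonempty topological space $X$ and a subset $A\subseteq X$ such that for all $o_1,o_2\in\mathrm{KF}$: $o_1A=o_2A\iff\{o_1,o_2\}\in C$. \textbf{Theorem.} $\mathrm{KF}$ has exactly $70$ local collapses. They are the following $70$ pairwise distinct collapses. In each row the chains of equal operators are listed; trivial chains are omitted, and for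 each listed chain $o_1=\dots=o_m$ its left dual $ao_1=\dots=ao_m$ (with $aao$ read as $o$) also belongs to the collapse. The collapse of the row consists of all pairs $\{o,o\}$ and all pairs of operators that lie in a common listed chain or in a common left dual of a listed chain. (1) (no chain) (2) $fbi=fib$ (3) $fif=fib$ (4) $fif=fbi$ (5) $fif=fbi=fib$ (6) $0=fif$; $if=bif$; $fbi=fib$ (7) $b=bib$; $fb=fib$ (8) $b=bib$; $fif=fb=fib$ (9) $b=bib$; $ff=fi$; $fb=fib$ (10) $b=bib$; $fif=fbi$; $ff=fi$; $fb=fib$ (11) $b=bib$; $ff=fi$; $fb=fbi=fib$ (12) $b=bib$; $fif=fb=fbi=fib$; $ff=fi$ (13) $b=bib$; $0=fif$; $if=bif$; $ff=fi$; $fb=fbi=fib$ (14) $i=ibi$; $fi=fbi$ (15) $i=ibi$; $fif=fi=fbi$ (16) $i=ibi$; $ff=fb$; $fi=fbi$ (17) $i=ibi$; $fif=fib$; $ff=fb$; $fi=fbi$ (18) $i=ibi$; $ff=fb$; $fi=fbi=fib$ (19) $i=ibi$; $fif=fi=fbi=fib$; $ff=fb$ (20) $i=ibi$; $0=fif$;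 $if=bif$; $ff=fb$; $fi=fbi=fib$ (21) $ib=bib$; $0=fib$; $fif=fbi$ (22) $bi=ibi$; $0=fbi$; $fif=fib$ (23) $b=bib$; $i=ibi$; $fb=fib$; $fi=fbi$ (24) $b=bib$; $i=ibi$; $ff=fb=fib$; $fi=fbi$ (25) $b=bib$; $i=ibi$; $ff=fi=fbi$; $fb=fib$ (26) $b=bib$; $i=ibi$; $ff=fb=fi=fbi=fib$ (27) $b=bib$; $i=ibi$; $f=bif$; $fif=ff$; $fb=fib$; $fi=fbi$ (28) $b=bib$; $i=ibi$; $f=bif$; $fif=ff=fb=fib$; $fi=fbi$ (29) $b=bib$; $i=ibi$; $f=bif$; $fif=ff=fi=fbi$; $fb=fib$ (30) $b=bib$; $i=ibi$; $f=bif$; $fif=ff=fb=fi=fbi=fib$ (31) $b=bib$; $i=ibi$; $0=fif$; $if=bif$; $ff=fb=fi=fbi=fib$ (32) $i=ibi$; $ib=bib$; $0=fib$; $fif=fi=fbi$ (33) $b=bib$; $bi=ibi$; $0=fbi$; $fif=fb=fib$ (34) $b=ib=bib$; $0=fb=fib$; $fif=fbi$; $ff=fi$ (35) $i=af$; $bi=aif$;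 $ibi=abif$; $0=fb=fib=ab=aib=abib$; $fif=fbi$; $ff=fi$ (36) $i=bi=ibi$; $0=fi=fbi$; $fif=fib$; $ff=fb$ (37) $b=f$; $i=bi=ibi=0=fi=fbi$; $ib=if$; $bib=bif$; $fif=fib$; $ff=fb$ (38) $bi=ibi$; $ib=bib$; $0=fif=fbi=fib$; $if=bif$ (39) $bi=bib$; $ib=ibi$; $0=if=fif=bif$; $f=ff$; $fbi=fib$ (40) $bi=ib=bib=ibi$; $0=if=fif=bif=fbi=fib$; $f=ff$ (41) $b=ib=bib$; $i=ibi$; $0=fb=fib$; $f=bif$; $fif=ff=fi=fbi$ (42) $i=ibi=af=abif$; $bi=aif$; $0=fb=fib=ab=aib=abib$; $fif=ff=fi=fbi$ (43) $b=bib$; $i=bi=ibi$; $0=fi=fbi$; $f=bif$; $fif=ff=fb=fib$ (44) $b=bib=f=bif$; $i=bi=ibi=0=fi=fbi$; $ib=if$; $fif=ff=fb=fib$ (45) $b=ib=bib$; $bi=ibi$; $0=fif=fb=fbi=fib$; $if=bif$; $ff=fi$ (46) $i=af$; $bi=ibi=aif=abif$; $0=fif=fb=fbi=fib=ab=aib=abib$;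 $ff=fi$ (47) $i=bi=ibi$; $ib=bib$; $0=fif=fi=fbi=fib$; $if=bif$; $ff=fb$ (48) $b=f$; $i=bi=ibi=0=fif=fi=fbi=fib$; $ib=bib=if=bif$; $ff=fb$ (49) $b=bi=bib$; $ib=ibi$; $0=if=fif=bif$; $f=ff=fi$; $fb=fbi=fib$ (50) $i=ib=ibi$; $bi=bib$; $0=if=fif=bif$; $f=ff=fb$; $fi=fbi=fib$ (51) $\mathsf{id}=i$; $b=bi=bib$; $ib=ibi$; $0=if=fif=bif$; $f=ff=fi$; $fb=fbi=fib$ (52) $\mathsf{id}=b$; $i=ib=ibi$; $bi=bib$; $0=if=fif=bif$; $f=ff=fb$; $fi=fbi=fib$ (53) $b=bi=ib=bib=ibi$; $0=if=fif=bif=fb=fbi=fib$; $f=ff=fi$ (54) $0=if=fif=bif=fb=fbi=fib=ab=abi=aib=abib=aibi$; $f=ff=fi=ai$ (55) $i=bi=ib=bib=ibi$; $0=if=fif=bif=fi=fbi=fib$; $f=ff=fb$ (56) $b=f=ff=fb$; $i=bi=ib=bib=ibi=0=if=fif=bif=fi=fbi=fib$ (57) $b=bi=bib$; $i=ib=ibi$;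 $0=if=fif=bif$; $f=ff=fb=fi=fbi=fib$ (58) $b=ib=bib$; $i=bi=ibi$; $0=fif=ff=fb=fi=fbi=fib$; $f=if=bif$ (59) $i=bi=ibi=af=aif=abif$; $0=fif=ff=fb=fi=fbi=fib=ab=aib=abib$ (60) $b=ib=bib=f=if=bif$; $i=bi=ibi=0=fif=ff=fb=fi=fbi=fib$ (61) $i=bi=ibi=0=fif=ff=fb=fi=fbi=fib=ab=aib=abib=af=aif=abif$ (62) $\mathsf{id}=b=bi=bib$; $i=ib=ibi$; $0=if=fif=bif$; $f=ff=fb=fi=fbi=fib$ (63) $\mathsf{id}=i=ib=ibi$; $b=bi=bib$; $0=if=fif=bif$; $f=ff=fb=fi=fbi=fib$ (64) $\mathsf{id}=i$; $b=bi=ib=bib=ibi$; $0=if=fif=bif=fb=fbi=fib$; $f=ff=fi$ (65) $0=if=fif=bif=fb=fbi=fib=ab=abi=aib=abib=aibi$; $f=ff=fi=a\mathsf{id}=ai$ (66) $\mathsf{id}=b$; $i=bi=ib=bib=ibi$; $0=if=fif=bif=fi=fbi=fib$; $f=ff=fb$ (67) $\mathsf{id}=b=f=ff=fb$; $i=bi=ib=bib=ibi=0=if=fif=bif=fi=fbi=fib$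 (68) $\mathsf{id}=b=i=bi=ib=bib=ibi$; $0=f=if=fif=bif=ff=fb=fi=fbi=fib$ (69) $0=f=if=fif=bif=ff=fb=fi=fbi=fib=a\mathsf{id}=ab=ai=abi=aib=abib=aibi$ (70) $\mathsf{id}=b=i=bi=ib=bib=ibi=0=f=if=fif=bif=ff=fb=fi=fbi=fib$ Moreover, all $70$ of them are satisfied by subsets of one and the same space, which can be taken to be a topological sum of four $11$-point spaces. -/

import Mathlib

universe u

/-- Names of the seventeen even operators: the products of closure `b`, interior `i` and
boundary `f`, where `ident` is the identity and `zero` the zero operator. A name is read as a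
composition (`fbi` sends `A` to `f (b (i A))`); in the names `i_f`, `fi_f`, `bi_f` the underscore has no
meaning. -/
inductive EvenOp : Type
  | ident | b | i | bi | ib | bib | ibi
  | zero | f | i_f | fi_f | bi_f | ff | fb | fi | fbi | fib
  deriving DecidableEq

/-- The set `o A` for an even operator `o` in a topological space. -/
def EvenOp.act {X : Type*} [TopologicalSpace X] : EvenOp → Set X → Set X
  | .ident, A => A
  | .b, A => closure A
  | .i, A => interior A
  | .bi, A => closure (interior A)
  | .ib, A => interior (closure A)
  | .bib, A => closure (interior (closure A))
  | .ibi, A => interior (closure (interior A))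
  | .zero, _ => ∅
  | .f, A => frontier A
  | .i_f, A => interior (frontier A)
  | .fi_f, A => frontier (interior (frontier A))
  | .bi_f, A => closure (interior (frontier A))
  | .ff, A => frontier (frontier A)
  | .fb, A => frontier (closure A)
  | .fi, A => frontier (interior A)
  | .fbi, A => frontier (closure (interior A))
  | .fib, A => frontier (interior (closure A))

/-- Names of the thirty-four Gaida-Eremenko operators: the even operators `o` and the
odd operators `a o`, where `a` is complement. -/
inductive KF : Type
  | even (o : EvenOp)
  | a (o : EvenOp)
  deriving DecidableEq

instance : Coe EvenOp KF := ⟨KF.even⟩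

/-- The set `o A` for a Gaida-Eremenko operator `o` in a topological space. -/
def KF.act {X : Type*} [TopologicalSpace X] : KF → Set X → Set X
  | .even o, A => o.act A
  | .a o, A => (o.act A)ᶜ

/-- The left dual of an operator: `o` and `a o` are interchanged. -/
def KF.leftDual : KF → KF
  | .even o => .a o
  | .a o => .even o

/-- A collapse is a set of unordered pairs of operators. -/
abbrev Collapse : Type := Set (Sym2 KF)

/-- `A` satisfies `C` when the equations `o₁ A = o₂ A` that hold are exactly those in `C`. -/
def SatisfiesCollapse {X : Type*} [TopologicalSpace X] (A : Set X) (C : Collapse) : Prop :=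
  ∀ o₁ o₂ : KF, o₁.act A = o₂.act A ↔ s(o₁, o₂) ∈ C

/-- A local collapse is one that is satisfied by some subset of some nonempty topological
space. -/
def IsLocalCollapse (C : Collapse) : Prop :=
  ∃ (X : Type u) (_ : TopologicalSpace X) (_ : Nonempty X) (A : Set X), SatisfiesCollapse A C

open EvenOp KF in
/-- The table of local collapses, numbered from 1 to 70. Each row lists chains of equal
operators. Trivial chains are omitted, and of a chain and its left dual (the chain of the left
duals of its members) only one is listed. -/
def collapseTable : ℕ → List (List KF)
  | 1 => []
  | 2 => [[fbi, fib]]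
  | 3 => [[fi_f, fib]]
  | 4 => [[fi_f, fbi]]
  | 5 => [[fi_f, fbi, fib]]
  | 6 => [[zero, fi_f], [i_f, bi_f], [fbi, fib]]
  | 7 => [[b, bib], [fb, fib]]
  | 8 => [[b, bib], [fi_f, fb, fib]]
  | 9 => [[b, bib], [ff, fi], [fb, fib]]
  | 10 => [[b, bib], [fi_f, fbi], [ff, fi], [fb, fib]]
  | 11 => [[b, bib], [ff, fi], [fb, fbi, fib]]
  | 12 => [[b, bib], [fi_f, fb, fbi, fib], [ff, fi]]
  | 13 => [[b, bib], [zero, fi_f], [i_f, bi_f], [ff, fi], [fb, fbi, fib]]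
  | 14 => [[i, ibi], [fi, fbi]]
  | 15 => [[i, ibi], [fi_f, fi, fbi]]
  | 16 => [[i, ibi], [ff, fb], [fi, fbi]]
  | 17 => [[i, ibi], [fi_f, fib], [ff, fb], [fi, fbi]]
  | 18 => [[i, ibi], [ff, fb], [fi, fbi, fib]]
  | 19 => [[i, ibi], [fi_f, fi, fbi, fib], [ff, fb]]
  | 20 => [[i, ibi], [zero, fi_f], [i_f, bi_f], [ff, fb], [fi, fbi, fib]]
  | 21 => [[ib, bib], [zero, fib], [fi_f, fbi]]
  | 22 => [[bi, ibi], [zero, fbi], [fi_f, fib]]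
  | 23 => [[b, bib], [i, ibi], [fb, fib], [fi, fbi]]
  | 24 => [[b, bib], [i, ibi], [ff, fb, fib], [fi, fbi]]
  | 25 => [[b, bib], [i, ibi], [ff, fi, fbi], [fb, fib]]
  | 26 => [[b, bib], [i, ibi], [ff, fb, fi, fbi, fib]]
  | 27 => [[b, bib], [i, ibi], [f, bi_f], [fi_f, ff], [fb, fib], [fi, fbi]]
  | 28 => [[b, bib], [i, ibi], [f, bi_f], [fi_f, ff, fb, fib], [fi, fbi]]
  | 29 => [[b, bib], [i, ibi], [f, bi_f], [fi_f, ff, fi, fbi], [fb, fib]]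
  | 30 => [[b, bib], [i, ibi], [f, bi_f], [fi_f, ff, fb, fi, fbi, fib]]
  | 31 => [[b, bib], [i, ibi], [zero, fi_f], [i_f, bi_f], [ff, fb, fi, fbi, fib]]
  | 32 => [[i, ibi], [ib, bib], [zero, fib], [fi_f, fi, fbi]]
  | 33 => [[b, bib], [bi, ibi], [zero, fbi], [fi_f, fb, fib]]
  | 34 => [[b, ib, bib], [zero, fb, fib], [fi_f, fbi], [ff, fi]]
  | 35 => [[i, a f], [bi, a i_f], [ibi, a bi_f], [zero, fb, fib, a b, a ib, a bib], [fi_f, fbi], [ff, fi]]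
  | 36 => [[i, bi, ibi], [zero, fi, fbi], [fi_f, fib], [ff, fb]]
  | 37 => [[b, f], [i, bi, ibi, zero, fi, fbi], [ib, i_f], [bib, bi_f], [fi_f, fib], [ff, fb]]
  | 38 => [[bi, ibi], [ib, bib], [zero, fi_f, fbi, fib], [i_f, bi_f]]
  | 39 => [[bi, bib], [ib, ibi], [zero, i_f, fi_f, bi_f], [f, ff], [fbi, fib]]
  | 40 => [[bi, ib, bib, ibi], [zero, i_f, fi_f, bi_f, fbi, fib], [f, ff]]
  | 41 => [[b, ib, bib], [i, ibi], [zero, fb, fib], [f, bi_f], [fi_f, ff, fi, fbi]]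
  | 42 => [[i, ibi, a f, a bi_f], [bi, a i_f], [zero, fb, fib, a b, a ib, a bib], [fi_f, ff, fi, fbi]]
  | 43 => [[b, bib], [i, bi, ibi], [zero, fi, fbi], [f, bi_f], [fi_f, ff, fb, fib]]
  | 44 => [[b, bib, f, bi_f], [i, bi, ibi, zero, fi, fbi], [ib, i_f], [fi_f, ff, fb, fib]]
  | 45 => [[b, ib, bib], [bi, ibi], [zero, fi_f, fb, fbi, fib], [i_f, bi_f], [ff, fi]]
  | 46 => [[i, a f], [bi, ibi, a i_f, a bi_f], [zero, fi_f, fb, fbi, fib, a b, a ib, a bib], [ff, fi]]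
  | 47 => [[i, bi, ibi], [ib, bib], [zero, fi_f, fi, fbi, fib], [i_f, bi_f], [ff, fb]]
  | 48 => [[b, f], [i, bi, ibi, zero, fi_f, fi, fbi, fib], [ib, bib, i_f, bi_f], [ff, fb]]
  | 49 => [[b, bi, bib], [ib, ibi], [zero, i_f, fi_f, bi_f], [f, ff, fi], [fb, fbi, fib]]
  | 50 => [[i, ib, ibi], [bi, bib], [zero, i_f, fi_f, bi_f], [f, ff, fb], [fi, fbi, fib]]
  | 51 => [[ident, i], [b, bi, bib], [ib, ibi], [zero, i_f, fi_f, bi_f], [f, ff, fi], [fb, fbi, fib]]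
  | 52 => [[ident, b], [i, ib, ibi], [bi, bib], [zero, i_f, fi_f, bi_f], [f, ff, fb], [fi, fbi, fib]]
  | 53 => [[b, bi, ib, bib, ibi], [zero, i_f, fi_f, bi_f, fb, fbi, fib], [f, ff, fi]]
  | 54 => [[zero, i_f, fi_f, bi_f, fb, fbi, fib, a b, a bi, a ib, a bib, a ibi], [f, ff, fi, a i]]
  | 55 => [[i, bi, ib, bib, ibi], [zero, i_f, fi_f, bi_f, fi, fbi, fib], [f, ff, fb]]
  | 56 => [[b, f, ff, fb], [i, bi, ib, bib, ibi, zero, i_f, fi_f, bi_f, fi, fbi, fib]]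
  | 57 => [[b, bi, bib], [i, ib, ibi], [zero, i_f, fi_f, bi_f], [f, ff, fb, fi, fbi, fib]]
  | 58 => [[b, ib, bib], [i, bi, ibi], [zero, fi_f, ff, fb, fi, fbi, fib], [f, i_f, bi_f]]
  | 59 => [[i, bi, ibi, a f, a i_f, a bi_f], [zero, fi_f, ff, fb, fi, fbi, fib, a b, a ib, a bib]]
  | 60 => [[b, ib, bib, f, i_f, bi_f], [i, bi, ibi, zero, fi_f, ff, fb, fi, fbi, fib]]
  | 61 => [[i, bi, ibi, zero, fi_f, ff, fb, fi, fbi, fib, a b, a ib, a bib, a f, a i_f, a bi_f]]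
  | 62 => [[ident, b, bi, bib], [i, ib, ibi], [zero, i_f, fi_f, bi_f], [f, ff, fb, fi, fbi, fib]]
  | 63 => [[ident, i, ib, ibi], [b, bi, bib], [zero, i_f, fi_f, bi_f], [f, ff, fb, fi, fbi, fib]]
  | 64 => [[ident, i], [b, bi, ib, bib, ibi], [zero, i_f, fi_f, bi_f, fb, fbi, fib], [f, ff, fi]]
  | 65 => [[zero, i_f, fi_f, bi_f, fb, fbi, fib, a b, a bi, a ib, a bib, a ibi], [f, ff, fi, a ident, a i]]
  | 66 => [[ident, b], [i, bi, ib, bib, ibi], [zero, i_f, fi_f, bi_f, fi, fbi, fib], [f, ff, fb]]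
  | 67 => [[ident, b, f, ff, fb], [i, bi, ib, bib, ibi, zero, i_f, fi_f, bi_f, fi, fbi, fib]]
  | 68 => [[ident, b, i, bi, ib, bib, ibi], [zero, f, i_f, fi_f, bi_f, ff, fb, fi, fbi, fib]]
  | 69 => [[zero, f, i_f, fi_f, bi_f, ff, fb, fi, fbi, fib, a ident, a b, a i, a bi, a ib, a bib, a ibi]]
  | 70 => [[ident, b, i, bi, ib, bib, ibi, zero, f, i_f, fi_f, bi_f, ff, fb, fi, fbi, fib]]
  | _ => []

/-- The collapse in row `n` of the table: two operators form a pair of it when they are equal,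
or lie in one listed chain, or their left duals lie in one listed chain. -/
def tableCollapse (n : ℕ) : Collapse :=
  {p | ∃ o₁ o₂ : KF, p = s(o₁, o₂) ∧
    (o₁ = o₂ ∨ ∃ c ∈ collapseTable n,
      (o₁ ∈ c ∧ o₂ ∈ c) ∨ (o₁.leftDual ∈ c ∧ o₂.leftDual ∈ c))}

/-! All operator values are Boolean combinations of A, bA, iA, biA, ibA, ibiA and bifA: bibA is the
union of biA and bifA, ifA is ibA minus biA, and the remaining boundaries are differences because a
closed set has boundary "set minus interior" and an open set "closure minus set". The relations
among these seven sets leave each point only sixteen possible cells (`inCell_of_base`,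
`exists_inCell`). Two operators agree on A iff no occupied cell lies in the symmetric difference of
their cell masks (`act_eq_act_iff`), so the collapse depends only on the pattern of occupied cells.

At most 70 collapses: topology makes some cells force others; for instance, A and its complement are
both dense in ifA. A search through all patterns respecting these implications meets only the codes
of the 70 rows (`exists_row_of_pattern`). That every such pattern is realized is neither claimed nor
needed.

At least 70: one explicit subset of a finite space per row is evaluated directly
(`satisfiesCollapse_rowWitnesses`). Rows differ because a collapse determines its code
(`patternCode_eq_of_land_eq_land_iff`) and the 70 codes are distinct. -/

/-! ### Cells, patterns and their enumeration -/

/-- The value of an operator when `w` gives the values of the even operators and complement is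
exclusive or with `T`. -/
def KF.value (T : ℕ) (w : EvenOp → ℕ) : KF → ℕ
  | .even o => w o
  | .a o => Nat.xor T (w o)

/-- The cells containing the sets `o A`, as bit masks. The sixteen cells are determined by
membership in `iA`, `ibiA`, `ibA`, `biA`, `bA`, `bifA` and `A`. -/
def EvenOp.cellMask : EvenOp → ℕ
  | .ident => 27285 | .b => 65503 | .i => 1 | .bi => 4039 | .ib => 223 | .bib => 16351
  | .ibi => 7 | .zero => 0 | .f => 65502 | .i_f => 24 | .fi_f => 15552 | .bi_f => 15576
  | .ff => 65478 | .fb => 65280 | .fi => 4038 | .fbi => 4032 | .fib => 16128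

/-- The cells in which a Gaida-Eremenko operator takes its values, as a bit mask. -/
def KF.cellMask : KF → ℕ := KF.value 65535 EvenOp.cellMask

/-- The nonzero symmetric differences of the cell masks of two operators. -/
def cellDiffs : List ℕ := [
  1, 6, 7, 24, 25, 31, 32, 33, 38, 39, 56, 57, 62, 198, 199, 216, 222, 223, 230, 231, 248, 254,
  255, 775, 799, 960, 984, 3864, 3865, 3871, 3896, 3897, 3903, 4032, 4033, 4038, 4039, 4056,
  4062, 4063, 4064, 4065, 4070, 4071, 4089, 4094, 4095, 12312, 12313, 12319, 12480, 12486, 12487,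
  13056, 13062, 13063, 13080, 13086, 13087, 15367, 15391, 15399, 15423, 15552, 15553, 15559,
  15576, 15577, 15583, 15584, 15585, 15608, 15609, 16128, 16129, 16135, 16152, 16160, 16161,
  16185, 16327, 16344, 16350, 16351, 16358, 16382, 16383, 21834, 21909, 22093, 22101, 25938,
  25939, 25941, 27210, 27242, 27277, 27282, 27284, 27285, 27308, 27316, 27317, 38218, 38219,
  38227, 38250, 38251, 38253, 38258, 38293, 38325, 39594, 39596, 39597, 43434, 43442, 43626,
  43701, 49152, 49153, 49177, 49184, 49185, 49191, 49208, 49350, 49374, 49375, 49383, 49400,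
  49406, 49407, 49926, 49927, 49950, 49951, 49952, 49958, 49959, 49976, 49982, 49983, 50112,
  50136, 50144, 50168, 52448, 52449, 52455, 52472, 52473, 52479, 53048, 53049, 53055, 53216,
  53222, 53223, 61440, 61441, 61446, 61464, 61465, 61470, 61471, 61472, 61473, 61479, 61496,
  61497, 61502, 61503, 61632, 61638, 61639, 61664, 61670, 61671, 64551, 64575, 64736, 64760,
  65280, 65281, 65287, 65304, 65305, 65312, 65313, 65319, 65336, 65337, 65473, 65478, 65479,
  65496, 65497, 65502, 65503, 65504, 65510, 65511, 65528, 65529, 65534, 65535]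

/-- The binary code of the inequalities `o₁ A ≠ o₂ A` when `P` is the mask of the nonempty
cells. -/
def patternCode (P : ℕ) : ℕ :=
  cellDiffs.foldr (fun d c => Nat.add (Nat.mul 2 c) (!Nat.beq (Nat.land P d) 0).toNat) 0

/-- For each cell, the mask of earlier cells that are nonempty if it is. -/
def cellNeeds : List ℕ := [0, 1, 2, 0, 8, 0, 17, 17, 33, 33, 41, 41, 40, 40, 32, 16384]

/-- For row `n` of the table at index `n - 1`, the mask of the nonempty cells of a set satisfying
the collapse of the row. -/
def rowPatterns : List ℕ := [
  16763, 17723, 21563, 17531, 17467, 16699, 4219, 5179, 379, 1147, 1339, 1083, 315, 16761, 17529,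
  20793, 21561, 17721, 17465, 16697, 16507, 20539, 4473, 4409, 377, 1337, 4217, 5177, 1145, 1081,
  313, 16505, 4155, 123, 91, 20537, 20536, 16443, 16675, 16419, 121, 89, 4153, 4152, 59, 27,
  16441, 16440, 547, 16673, 291, 16929, 39, 7, 49185, 49184, 801, 57, 25, 56, 24, 545, 289, 35,
  3, 16417, 16416, 33, 1, 32]

/-- The codes of the collapses of the rows. -/
def rowCodes : List ℕ := rowPatterns.map patternCode

/-- The pattern `P` with code `c` is not the pattern of a set, or is that of a row. -/
def goodPattern (P c : ℕ) : Bool :=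
  Nat.beq P 0 || Nat.beq (Nat.land P 24) 8 || rowCodes.any (Nat.beq c)

/-- All patterns that extend `P`, from the cell `k` on, by cells with needs `l` are good. -/
def allPatternsGood : List ℕ → ℕ → ℕ → ℕ → Bool
  | [], _, P, c => goodPattern P c
  | m :: l, k, P, c => allPatternsGood l (Nat.succ k) P c &&
      (!Nat.beq (Nat.land P m) m ||
        allPatternsGood l (Nat.succ k) (Nat.add P (Nat.pow 2 k))
          (Nat.lor c (patternCode (Nat.pow 2 k))))

set_option maxRecDepth 100000 in
-- Needs refer to earlier cells only, so one pass over the cells suffices. The implication from cell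
-- 3 to cell 4 looks ahead and is therefore tested at the end, in `goodPattern`.
theorem allPatternsGood_cellNeeds : allPatternsGood cellNeeds 0 0 0 = true := by
  decide +kernel

set_option maxRecDepth 100000 in
theorem nodup_rowCodes : rowCodes.Nodup := by
  decide +kernel

/-! ### Comparing values with chains of equal operators -/

/-- A code of the even operators, distinct ones below 17. -/
def EvenOp.code : EvenOp → ℕ
  | .ident => 0 | .b => 1 | .i => 2 | .bi => 3 | .ib => 4 | .bib => 5 | .ibi => 6 | .zero => 7
  | .f => 8 | .i_f => 9 | .fi_f => 10 | .bi_f => 11 | .ff => 12 | .fb => 13 | .fi => 14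
  | .fbi => 15 | .fib => 16

def KF.code : KF → ℕ
  | .even o => o.code
  | .a o => Nat.add 17 o.code

def EvenOp.list : List EvenOp :=
  [.ident, .b, .i, .bi, .ib, .bib, .ibi, .zero, .f, .i_f, .fi_f, .bi_f, .ff, .fb, .fi, .fbi, .fib]

def KF.list : List KF := EvenOp.list.map KF.even ++ EvenOp.list.map KF.a

/-- List membership of operators, decided by their codes. -/
def KF.memb (o : KF) (c : List KF) : Bool := c.any fun p => Nat.beq o.code p.code

/-- Whether two operators are equal in the collapse given by the chains `t`. -/
def chainsRel (t : List (List KF)) (o₁ o₂ : KF) : Bool :=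
  Nat.beq o₁.code o₂.code || t.any fun c =>
    (o₁.memb c && o₂.memb c) || (o₁.leftDual.memb c && o₂.leftDual.memb c)

/-- The values `v` are constant on each chain of `t` and on its left dual. -/
def chainsConstant (t : List (List KF)) (v : KF → ℕ) : Bool :=
  t.all fun c => c.all fun o =>
    Nat.beq (v o) (v (c.headD o)) && Nat.beq (v o.leftDual) (v (c.headD o).leftDual)

/-- The equations among the values `v` are those given by the chains `t`. -/
def chainsMatch (t : List (List KF)) (v : KF → ℕ) : Bool :=
  chainsConstant t v && KF.list.all fun o₁ => KF.list.all fun o₂ =>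
    !Nat.beq (v o₁) (v o₂) || chainsRel t o₁ o₂

set_option maxRecDepth 100000 in
-- This ties the codes to the table; both the covering argument and the distinctness of the rows
-- rest on it.
theorem rowPatterns_match :
    ((List.range 70).all fun n => chainsMatch (collapseTable (n + 1)) fun o =>
      Nat.land (rowPatterns.getD n 0) o.cellMask) = true := by
  decide +kernel

/-! ### Bit-mask topology on the witness space -/

/-- The mask of the minimal neighbourhood of a point of the space on `Fin 11`: its points lie in
clusters `{0, 1}`, `{2, 3}`, `{4, 5}`, `{6, 7, 8}`, `{9, 10}`, where the first three are open and
the last two lie below these. -/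
def nhdMask : ℕ → ℕ
  | 0 => 3 | 1 => 3 | 2 => 12 | 3 => 12 | 4 => 48 | 5 => 48
  | 6 => 511 | 7 => 511 | 8 => 511 | 9 => 1599 | 10 => 1599 | _ => 0

/-- The closure of a set of points of the sum of four copies, with masks juxtaposed. -/
def clMask (B : ℕ) : ℕ :=
  (List.range 44).foldr (fun x c => Nat.add (Nat.mul 2 c) (!Nat.beq (Nat.land B
    (Nat.shiftLeft (nhdMask (x % 11)) (11 * (x / 11)))) 0).toNat) 0

/-- The complement of a set of points. -/
def coMask (B : ℕ) : ℕ := Nat.xor 17592186044415 B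

/-- The interior of a set of points. -/
def intMask (B : ℕ) : ℕ := coMask (clMask (coMask B))

/-- The boundary of a set of points. -/
def frMask (B : ℕ) : ℕ := Nat.land (clMask B) (clMask (coMask B))

/-- The action of the even operators on masks. -/
def EvenOp.actMask : EvenOp → ℕ → ℕ
  | .ident, A => A
  | .b, A => clMask A
  | .i, A => intMask A
  | .bi, A => clMask (intMask A)
  | .ib, A => intMask (clMask A)
  | .bib, A => clMask (intMask (clMask A))
  | .ibi, A => intMask (clMask (intMask A))
  | .zero, _ => 0
  | .f, A => frMask A
  | .i_f, A => intMask (frMask A)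
  | .fi_f, A => frMask (intMask (frMask A))
  | .bi_f, A => clMask (intMask (frMask A))
  | .ff, A => frMask (frMask A)
  | .fb, A => frMask (clMask A)
  | .fi, A => frMask (intMask A)
  | .fbi, A => frMask (clMask (intMask A))
  | .fib, A => frMask (intMask (clMask A))

/-- For row `n` of the table at index `n - 1`, the mask of a set satisfying its collapse. -/
def rowWitnesses : List ℕ := [
  3848303327295, 3848320063551, 3848294905919, 3848320104511, 3848320188415, 3848303323199,
  8686534655, 8619425791, 25866403839, 60226142207, 60142256127, 60397977599, 25858015231,
  3848303329279, 3848320106495, 3848294899711, 3848294907903, 3848320065535, 3848324251647,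
  3848303325183, 3848387297279, 3848295022591, 8602566655, 8606711807, 25870467071, 60146319359,
  8690597887, 8623489023, 60230205439, 68719476735, 25862078463, 3848391360511, 8858370047,
  197568626687, 197836931071, 3848299085823, 3848294934549, 3848378908671, 3848303411199,
  3848559132671, 197572689919, 206158430207, 17179869183, 8678058005, 88211455, 180657061887,
  3848382971903, 3848378820629, 17068468469759, 3848307474431, 26038239231, 3856628973567,
  536870911, 1099511627775, 558345748479, 549755813888, 584115552255, 92274687, 188978561023,
  88123413, 180476749845, 17076789968895, 34359738367, 268435455, 549755813887, 3856880631807,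
  3848290697216, 8589934591, 17592186044415, 0]

set_option maxRecDepth 100000 in
-- Here the operators are evaluated in the finite space itself; cells play no part.
theorem rowWitnesses_match :
    ((List.range 70).all fun n => chainsMatch (collapseTable (n + 1))
      (KF.value 17592186044415 fun o => o.actMask (rowWitnesses.getD n 0))) = true := by
  decide +kernel

/-! ### Correctness of the chain comparison -/

theorem EvenOp.code_injective : Function.Injective EvenOp.code := by
  intro o p h
  cases o <;> cases p <;> first | rfl | (simp [EvenOp.code] at h)

theorem EvenOp.code_lt (o : EvenOp) : o.code < 17 := by cases o <;> decide

theorem KF.code_injective : Function.Injective KF.code := by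
  intro o p h
  rcases o with o | o <;> rcases p with p | p <;> simp only [KF.code, Nat.add_eq] at h
  · rw [EvenOp.code_injective h]
  · have := o.code_lt; omega
  · have := p.code_lt; omega
  · rw [EvenOp.code_injective (Nat.add_left_cancel h)]

theorem EvenOp.mem_list (o : EvenOp) : o ∈ EvenOp.list := by cases o <;> simp [EvenOp.list]

theorem KF.mem_list (o : KF) : o ∈ KF.list := by
  rcases o with o | o <;> simp [KF.list, EvenOp.mem_list]

theorem KF.memb_iff (o : KF) (c : List KF) : o.memb c = true ↔ o ∈ c := by
  simp only [KF.memb, List.any_eq_true, Nat.beq_eq]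
  constructor
  · rintro ⟨p, hp, h⟩
    rwa [KF.code_injective h]
  · exact fun h => ⟨o, h, rfl⟩

theorem KF.leftDual_leftDual (o : KF) : o.leftDual.leftDual = o := by cases o <;> rfl

theorem chainsRel_iff (t : List (List KF)) (o₁ o₂ : KF) :
    chainsRel t o₁ o₂ = true ↔ o₁ = o₂ ∨ ∃ c ∈ t,
      (o₁ ∈ c ∧ o₂ ∈ c) ∨ (o₁.leftDual ∈ c ∧ o₂.leftDual ∈ c) := by
  simp only [chainsRel, Bool.or_eq_true, Nat.beq_eq, KF.code_injective.eq_iff,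
    List.any_eq_true, Bool.and_eq_true, KF.memb_iff]

/-- Comparison with the head of the chain gives equality along it; the test over all pairs excludes
further equations. -/
theorem eq_iff_chainsRel_of_chainsMatch {t : List (List KF)} {v : KF → ℕ}
    (h : chainsMatch t v = true) (o₁ o₂ : KF) : v o₁ = v o₂ ↔ chainsRel t o₁ o₂ = true := by
  simp only [chainsMatch, chainsConstant, Bool.and_eq_true, List.all_eq_true, Nat.beq_eq,
    Bool.or_eq_true, Bool.not_eq_true'] at h
  obtain ⟨hc, hr⟩ := h
  constructor
  · intro e
    rcases hr o₁ o₁.mem_list o₂ o₂.mem_list with h | h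
    · rw [e] at h
      simp at h
    · exact h
  -- On a nonempty chain the default of `headD` is irrelevant.
  · have head : ∀ c : List KF, ∀ o p : KF, o ∈ c → c.headD o = c.headD p := by
      intro c o p ho
      cases c
      · simp at ho
      · rfl
    rw [chainsRel_iff]
    rintro (rfl | ⟨c, hct, ⟨h₁, h₂⟩ | ⟨h₁, h₂⟩⟩)
    · rfl
    · rw [(hc c hct o₁ h₁).1, (hc c hct o₂ h₂).1, head c o₁ o₂ h₁]
    · have e₁ := (hc c hct _ h₁).2
      have e₂ := (hc c hct _ h₂).2
      rw [KF.leftDual_leftDual] at e₁ e₂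
      rw [e₁, e₂, head c _ o₂.leftDual h₁]

theorem mem_tableCollapse (n : ℕ) (o₁ o₂ : KF) :
    s(o₁, o₂) ∈ tableCollapse n ↔ chainsRel (collapseTable n) o₁ o₂ = true := by
  rw [chainsRel_iff]
  constructor
  · rintro ⟨p₁, p₂, e, h⟩
    rcases Sym2.eq_iff.1 e with ⟨rfl, rfl⟩ | ⟨rfl, rfl⟩
    · exact h
    · rcases h with h | ⟨c, hc, h⟩
      · exact .inl h.symm
      · exact .inr ⟨c, hc, h.imp And.symm And.symm⟩
  · exact fun h => ⟨o₁, o₂, rfl, h⟩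

/-! ### Patterns -/

/-- The parity of a code recovers the test for the first difference, and halving leaves the code of
the rest. -/
theorem patternCode_foldr_inj (l : List ℕ) (P Q : ℕ)
    (h : l.foldr (fun d c => Nat.add (Nat.mul 2 c) (!Nat.beq (Nat.land P d) 0).toNat) 0 =
      l.foldr (fun d c => Nat.add (Nat.mul 2 c) (!Nat.beq (Nat.land Q d) 0).toNat) 0) :
    ∀ d ∈ l, P &&& d = 0 ↔ Q &&& d = 0 := by
  induction l with
  | nil => simp
  | cons d l ih =>
    simp only [List.foldr_cons, Nat.add_eq, Nat.mul_eq] at h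
    have b₁ := Bool.toNat_lt (!Nat.beq (Nat.land P d) 0)
    have b₂ := Bool.toNat_lt (!Nat.beq (Nat.land Q d) 0)
    rintro e (_ | ⟨_, he⟩)
    · have h' : (!Nat.beq (Nat.land P d) 0).toNat = (!Nat.beq (Nat.land Q d) 0).toNat := by omega
      have h'' : Nat.beq (Nat.land P d) 0 = Nat.beq (Nat.land Q d) 0 := by
        revert h'
        cases Nat.beq (Nat.land P d) 0 <;> cases Nat.beq (Nat.land Q d) 0 <;> simp
      change Nat.land P d = 0 ↔ Nat.land Q d = 0
      rw [← Nat.beq_eq, ← Nat.beq_eq]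
      exact Bool.eq_iff_iff.1 h''
    · exact ih (by simp only [Nat.add_eq, Nat.mul_eq]; omega) e he

theorem land_eq_land_iff (P a b : ℕ) : P &&& a = P &&& b ↔ P &&& (a ^^^ b) = 0 := by
  rw [Nat.and_xor_distrib_left, Nat.xor_eq_zero_iff]

set_option maxRecDepth 100000 in
-- `cellDiffs` is complete, so a code decides every equation between operators.
theorem xor_cellMask_mem (o₁ o₂ : KF) :
    o₁.cellMask ^^^ o₂.cellMask = 0 ∨ o₁.cellMask ^^^ o₂.cellMask ∈ cellDiffs := by
  have h : (KF.list.all fun o₁ => KF.list.all fun o₂ =>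
      Nat.beq (Nat.xor o₁.cellMask o₂.cellMask) 0 ||
        cellDiffs.any (Nat.beq (Nat.xor o₁.cellMask o₂.cellMask))) = true := by decide +kernel
  simp only [List.all_eq_true, Bool.or_eq_true, Nat.beq_eq, List.any_eq_true] at h
  rcases h o₁ o₁.mem_list o₂ o₂.mem_list with h | ⟨d, hd, h⟩
  · exact .inl h
  · exact .inr (by rw [← h] at hd; exact hd)

theorem land_eq_land_iff_of_patternCode_eq {P Q : ℕ} (h : patternCode P = patternCode Q)
    (o₁ o₂ : KF) : P &&& o₁.cellMask = P &&& o₂.cellMask ↔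
      Q &&& o₁.cellMask = Q &&& o₂.cellMask := by
  rw [land_eq_land_iff, land_eq_land_iff]
  rcases xor_cellMask_mem o₁ o₂ with h' | h'
  · simp [h']
  · exact patternCode_foldr_inj _ P Q h _ h'

/-- A union of cells meets a difference iff one of its parts does. Hence the search can update codes
one cell at a time. -/
theorem patternCode_lor (P Q : ℕ) : patternCode (P ||| Q) = patternCode P ||| patternCode Q := by
  have key : ∀ a b : ℕ, ∀ x y : Bool, 2 * (a ||| b) + (x || y).toNat =
      (2 * a + x.toNat) ||| (2 * b + y.toNat) := by
    intro a b x y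
    have := Nat.lor_bit x a y b
    simpa [Nat.bit_val] using this.symm
  have beq0 : ∀ n : ℕ, Nat.beq n 0 = decide (n = 0) := by
    intro n; rw [Bool.eq_iff_iff, Nat.beq_eq, decide_eq_true_iff]
  unfold patternCode
  induction cellDiffs with
  | nil => simp
  | cons d l ih =>
    simp only [List.foldr_cons, Nat.add_eq, Nat.mul_eq] at ih ⊢
    rw [ih, ← key]
    congr 2
    change (!Nat.beq ((P ||| Q) &&& d) 0) = (!Nat.beq (P &&& d) 0 || !Nat.beq (Q &&& d) 0)
    simp only [beq0, Nat.and_or_distrib_right, Nat.or_eq_zero_iff, Bool.decide_and, Bool.not_and]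

/-- The search follows the truncations of `P`: bit `k` selects the branch at cell `k`, and the needs
keep that branch open. -/
theorem goodPattern_of_allPatternsGood {P : ℕ} (l : List ℕ) (k : ℕ)
    (hl : ∀ j m, l[j]? = some m → P.testBit (k + j) = true → P % 2 ^ (k + j) &&& m = m)
    (h : allPatternsGood l k (P % 2 ^ k) (patternCode (P % 2 ^ k)) = true) :
    goodPattern (P % 2 ^ (k + l.length)) (patternCode (P % 2 ^ (k + l.length))) = true := by
  induction l generalizing k with
  | nil => simpa [allPatternsGood] using h
  | cons m l ih =>
    simp only [allPatternsGood, Bool.and_eq_true, Bool.or_eq_true, Bool.not_eq_true',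
      Nat.succ_eq_add_one] at h
    have e : k + (m :: l).length = k + 1 + l.length := by simp; omega
    rw [e]
    apply ih
    · intro j m' hj
      have := hl (j + 1) m' (by simpa using hj)
      rwa [show k + (j + 1) = k + 1 + j by omega] at this
    · rw [Nat.mod_pow_succ, ← Nat.toNat_testBit]
      cases hb : P.testBit k
      · simpa using h.1
      · have hm : Nat.land (P % 2 ^ k) m = m := hl 0 m rfl hb
        have hlt : P % 2 ^ k < 2 ^ k := Nat.mod_lt _ (by positivity)
        -- The new bit lies above the truncation, so there is no carry.
        have hadd : P % 2 ^ k + 2 ^ k = P % 2 ^ k ||| 2 ^ k := by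
          have := Nat.two_pow_add_eq_or_of_lt hlt 1
          rw [mul_one] at this
          rw [add_comm, this, Nat.or_comm]
        rcases h.2 with h | h
        · rw [hm] at h
          simp at h
        · simp only [Bool.toNat_true, mul_one]
          rw [hadd, patternCode_lor]
          rw [← hadd]
          exact h

set_option maxRecDepth 100000 in
/-- A pattern with the needs of its cells has the code of a row. -/
theorem exists_row_of_pattern {P : ℕ} (hP : P < 2 ^ 16) (h0 : P ≠ 0) (h24 : P &&& 24 ≠ 8)
    (hl : ∀ j m, cellNeeds[j]? = some m → P.testBit j = true → P % 2 ^ j &&& m = m) :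
    ∃ n < 70, patternCode P = patternCode (rowPatterns.getD n 0) := by
  have h := goodPattern_of_allPatternsGood (P := P) cellNeeds 0 (by simpa using hl)
    (by rw [pow_zero, Nat.mod_one]; exact allPatternsGood_cellNeeds)
  rw [show 0 + cellNeeds.length = 16 from rfl, Nat.mod_eq_of_lt hP] at h
  simp only [goodPattern, Bool.or_eq_true, Nat.beq_eq, List.any_eq_true] at h
  rcases h with (h | h) | ⟨c, hc, h⟩
  · exact absurd h h0
  · exact absurd h h24
  · obtain ⟨Q, hQ, rfl⟩ := List.mem_map.1 hc
    obtain ⟨n, hn, rfl⟩ := List.mem_iff_getElem.1 hQ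
    exact ⟨n, hn, by rw [h, List.getD_eq_getElem _ _ hn]⟩

/-! ### The sixteen cells of a subset -/

section Cells

variable {X : Type*} [TopologicalSpace X] {A : Set X} {x : X}

theorem interior_frontier_eq (A : Set X) :
    interior (frontier A) = interior (closure A) \ closure (interior A) := by
  rw [frontier, Set.sdiff_eq, interior_inter, interior_compl]; rfl

theorem interior_closure_interior_subset (A : Set X) :
    interior (closure (interior A)) ⊆ interior (closure A) :=
  interior_mono (closure_mono interior_subset)

/-- The complement of ibiA is the closure of the complement of biA; within the open set ibA, its
points are limits of ibA minus biA, which is ifA. -/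
theorem diff_interior_subset_closure_interior_frontier (A : Set X) :
    interior (closure A) \ interior (closure (interior A)) ⊆ closure (interior (frontier A)) := by
  rw [interior_frontier_eq, Set.sdiff_eq, ← closure_compl]
  rintro x ⟨hx, hx'⟩
  have := isOpen_interior.inter_closure (s := interior (closure A)) (t := (closure (interior A))ᶜ)
    ⟨hx, hx'⟩
  exact this

theorem closure_interior_closure_eq (A : Set X) :
    closure (interior (closure A)) = closure (interior A) ∪ closure (interior (frontier A)) := by
  apply subset_antisymm
  · rw [← closure_union]
    apply closure_minimal _ isClosed_closure
    intro x hx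
    rw [closure_union]
    by_cases h : x ∈ closure (interior A)
    · exact .inl h
    · exact .inr (subset_closure (by rw [interior_frontier_eq]; exact ⟨hx, h⟩))
  · apply Set.union_subset
    · exact closure_mono (interior_mono subset_closure)
    · exact closure_mono (interior_mono frontier_subset_closure)

theorem disjoint_closure_interior_frontier (A : Set X) :
    Disjoint (closure (interior (frontier A))) (interior (closure (interior A))) := by
  apply Disjoint.closure_left _ isOpen_interior
  rw [interior_frontier_eq]
  exact Set.disjoint_left.2 fun x hx hx' => hx.2 (interior_subset hx')

/-- The point `x` lies in the cell `k` of `A`. -/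
def InCell (A : Set X) (x : X) (k : ℕ) : Prop :=
  ∀ o : EvenOp, x ∈ o.act A ↔ o.cellMask.testBit k = true

theorem inCell_of_base (k : Fin 16)
    (h : ∀ o ∈ [EvenOp.ident, .b, .i, .bi, .ib, .ibi, .bi_f],
      (x ∈ o.act A ↔ o.cellMask.testBit k = true)) : InCell A x k := by
  have hid := h .ident (by simp)
  have hb := h .b (by simp)
  have hi := h .i (by simp)
  have hbi := h .bi (by simp)
  have hib := h .ib (by simp)
  have hibi := h .ibi (by simp)
  have hbif := h .bi_f (by simp)
  have hbib : x ∈ EvenOp.bib.act A ↔ EvenOp.bib.cellMask.testBit k = true := by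
    have : ∀ k : Fin 16, EvenOp.bib.cellMask.testBit k =
      (EvenOp.bi.cellMask.testBit k || EvenOp.bi_f.cellMask.testBit k) := by decide
    rw [this, Bool.or_eq_true, ← hbi, ← hbif]
    exact Set.ext_iff.1 (closure_interior_closure_eq A) x
  have sdiff : ∀ (o p q : EvenOp), o.act A = p.act A \ q.act A →
      (∀ k : Fin 16, o.cellMask.testBit k = (p.cellMask.testBit k && !q.cellMask.testBit k)) →
      (x ∈ p.act A ↔ p.cellMask.testBit k = true) → (x ∈ q.act A ↔ q.cellMask.testBit k = true) →
      (x ∈ o.act A ↔ o.cellMask.testBit k = true) := by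
    intro o p q e hk hp hq
    rw [e, hk, Set.mem_sdiff, hp, hq, Bool.and_eq_true, Bool.not_eq_true', Bool.not_eq_true]
  have hf := sdiff .f .b .i rfl (by decide) hb hi
  have hif := sdiff .i_f .ib .bi (interior_frontier_eq A) (by decide) hib hbi
  rintro (_ | _)
  · exact hid
  · exact hb
  · exact hi
  · exact hbi
  · exact hib
  · exact hbib
  · exact hibi
  · simp [EvenOp.act, EvenOp.cellMask]
  · exact hf
  · exact hif
  · exact sdiff .fi_f .bi_f .i_f isOpen_interior.frontier_eq (by decide) hbif hif
  · exact hbif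
  · exact sdiff .ff .f .i_f isClosed_frontier.frontier_eq (by decide) hf hif
  · exact sdiff .fb .b .ib isClosed_closure.frontier_eq (by decide) hb hib
  · exact sdiff .fi .bi .i isOpen_interior.frontier_eq (by decide) hbi hi
  · exact sdiff .fbi .bi .ibi isClosed_closure.frontier_eq (by decide) hbi hibi
  · exact sdiff .fib .bib .ib isOpen_interior.frontier_eq (by decide) hbib hib

set_option synthInstance.maxSize 1000 in
-- The hypotheses are the relations among the seven basic sets; sixteen membership vectors are all
-- that can survive them.
theorem exists_base_cell : ∀ id b i bi ib ibi e : Bool, (i → id) → (id → b) → (i → ibi) →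
    (ibi → ib) → (ibi → bi) → (ib → b) → (bi → b) → (e → b) → (ibi → !e) →
    (ib → !ibi → e) → ∃ k : Fin 16,
      id = EvenOp.ident.cellMask.testBit k ∧ b = EvenOp.b.cellMask.testBit k ∧
      i = EvenOp.i.cellMask.testBit k ∧ bi = EvenOp.bi.cellMask.testBit k ∧
      ib = EvenOp.ib.cellMask.testBit k ∧ ibi = EvenOp.ibi.cellMask.testBit k ∧
      e = EvenOp.bi_f.cellMask.testBit k := by
  decide

theorem exists_inCell (A : Set X) (x : X) : ∃ k : Fin 16, InCell A x k := by
  classical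
  obtain ⟨k, h₁, h₂, h₃, h₄, h₅, h₆, h₇⟩ := exists_base_cell (decide (x ∈ A))
    (decide (x ∈ closure A)) (decide (x ∈ interior A)) (decide (x ∈ closure (interior A)))
    (decide (x ∈ interior (closure A))) (decide (x ∈ interior (closure (interior A))))
    (decide (x ∈ closure (interior (frontier A))))
    (by simpa using fun h => interior_subset h)
    (by simpa using fun h => subset_closure h)
    (by simpa using fun h => interior_maximal subset_closure isOpen_interior h)
    (by simpa using fun h => interior_closure_interior_subset A h)
    (by simpa using fun h => interior_subset h)
    (by simpa using fun h => interior_subset h)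
    (by simpa using fun h => closure_mono interior_subset h)
    (by simpa using fun h =>
          closure_minimal (interior_subset.trans frontier_subset_closure) isClosed_closure h)
    (by simpa using fun h h' => Set.disjoint_left.1 (disjoint_closure_interior_frontier A) h' h)
    (by simpa using fun h h' => diff_interior_subset_closure_interior_frontier A ⟨h, h'⟩)
  refine ⟨k, inCell_of_base k ?_⟩
  simp only [List.forall_mem_cons, List.not_mem_nil, false_imp_iff, implies_true, and_true,
    ← h₁, ← h₂, ← h₃, ← h₄, ← h₅, ← h₆, ← h₇, decide_eq_true_iff]
  exact ⟨.rfl, .rfl, .rfl, .rfl, .rfl, .rfl, .rfl⟩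

/-! ### Implications between nonempty cells -/

theorem inCell_of_forall {j : Fin 16} (p : Fin 16 → Bool)
    (hp : ∀ k : Fin 16, InCell A x k → p k = true) (hj : ∀ k, p k = true → k = j) : InCell A x j := by
  obtain ⟨k, hk⟩ := exists_inCell A x
  exact hj k (hp k hk) ▸ hk

theorem exists_inCell_zero (h : x ∈ closure (interior A)) : ∃ y, InCell A y 0 := by
  obtain ⟨y, hy⟩ := closure_nonempty_iff.1 ⟨x, h⟩
  exact ⟨y, inCell_of_forall (j := 0) (fun k => EvenOp.i.cellMask.testBit k)
    (fun k hk => (hk .i).1 hy) (by decide)⟩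

/-- Cell 1 is ibiA minus A. Were it empty, the open set ibiA would lie in iA. -/
theorem exists_inCell_one (h : x ∈ interior (closure (interior A))) (h' : x ∉ interior A) :
    ∃ y, InCell A y 1 := by
  have : ¬interior (closure (interior A)) ⊆ A := fun hs => h' (interior_maximal hs isOpen_interior h)
  obtain ⟨y, hy, hyA⟩ := Set.not_subset.1 this
  exact ⟨y, inCell_of_forall (j := 1)
    (fun k => EvenOp.ibi.cellMask.testBit k && !EvenOp.ident.cellMask.testBit k)
    (fun k hk => by
      rw [Bool.and_eq_true, Bool.not_eq_true', ← Bool.not_eq_true, ← hk, ← hk]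
      exact ⟨hy, hyA⟩) (by decide)⟩

/-- Cell 3 is ifA minus A: boundary points are limits of the complement, so the open set ifA meets
it. -/
theorem exists_inCell_three (h : x ∈ closure (interior (frontier A))) : ∃ y, InCell A y 3 := by
  obtain ⟨z, hz⟩ := closure_nonempty_iff.1 ⟨x, h⟩
  have hz' := interior_subset hz
  rw [frontier_eq_closure_inter_closure] at hz'
  obtain ⟨y, hy, hyA⟩ := mem_closure_iff.1 hz'.2 _ isOpen_interior hz
  exact ⟨y, inCell_of_forall (j := 3)
    (fun k => EvenOp.i_f.cellMask.testBit k && !EvenOp.ident.cellMask.testBit k)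
    (fun k hk => by
      rw [Bool.and_eq_true, Bool.not_eq_true', ← Bool.not_eq_true, ← hk, ← hk]
      exact ⟨hy, hyA⟩) (by decide)⟩

theorem exists_inCell_four (h : x ∈ closure (interior (frontier A))) : ∃ y, InCell A y 4 := by
  obtain ⟨z, hz⟩ := closure_nonempty_iff.1 ⟨x, h⟩
  obtain ⟨y, hy, hyA⟩ := mem_closure_iff.1 (frontier_subset_closure (interior_subset hz)) _
    isOpen_interior hz
  exact ⟨y, inCell_of_forall (j := 4)
    (fun k => EvenOp.i_f.cellMask.testBit k && EvenOp.ident.cellMask.testBit k)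
    (fun k hk => by
      rw [Bool.and_eq_true, ← hk, ← hk]
      exact ⟨hy, hyA⟩) (by decide)⟩

theorem exists_inCell_five (h : x ∉ interior (closure A)) : ∃ y, InCell A y 5 := by
  have : closure A ≠ Set.univ := fun e => h (by rw [e, interior_univ]; trivial)
  obtain ⟨y, hy⟩ := (Set.ne_univ_iff_exists_notMem _).1 this
  exact ⟨y, inCell_of_forall (j := 5) (fun k => !EvenOp.b.cellMask.testBit k)
    (fun k hk => by
      rw [Bool.not_eq_true', ← Bool.not_eq_true, ← hk]
      exact hy) (by decide)⟩

/-- Cell 14 is A minus bibA: the complement of bibA is an open neighbourhood of `x`, so it meets A.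
-/
theorem exists_inCell_fourteen (h : x ∈ closure A) (h' : x ∉ closure (interior (closure A))) :
    ∃ y, InCell A y 14 := by
  obtain ⟨y, hy, hyA⟩ := mem_closure_iff.1 h _ isClosed_closure.isOpen_compl h'
  exact ⟨y, inCell_of_forall (j := 14)
    (fun k => EvenOp.ident.cellMask.testBit k && !EvenOp.bib.cellMask.testBit k)
    (fun k hk => by
      rw [Bool.and_eq_true, Bool.not_eq_true', ← Bool.not_eq_true, ← hk, ← hk]
      exact ⟨hyA, hy⟩) (by decide)⟩

/-! ### The pattern of a set determines its collapse -/

open Classical in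
/-- The mask of the nonempty cells of a set. -/
noncomputable def pattern (A : Set X) : ℕ :=
  Nat.ofBits fun k : Fin 16 => decide (∃ x : X, InCell A x k)

theorem pattern_testBit (A : Set X) (k : Fin 16) :
    (pattern A).testBit k = true ↔ ∃ x, InCell A x k := by
  classical
  rw [pattern, Nat.testBit_ofBits_lt _ _ k.2, decide_eq_true_eq]

theorem pattern_lt (A : Set X) : pattern A < 2 ^ 16 := Nat.ofBits_lt_two_pow _

theorem lt_of_pattern_testBit {k : ℕ} (h : (pattern A).testBit k = true) : k < 16 := by
  by_contra hk
  rw [pattern, Nat.testBit_ofBits_ge _ _ (not_lt.1 hk)] at h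
  simp at h

theorem pattern_ne_zero [Nonempty X] (A : Set X) : pattern A ≠ 0 := by
  intro h
  obtain ⟨k, hk⟩ := exists_inCell A (Classical.arbitrary X)
  have := (pattern_testBit A k).2 ⟨_, hk⟩
  simp [h] at this

/-- The mask 24 selects cells 3 and 4; the value 8 would leave A without points in a nonempty ifA.
-/
theorem pattern_and_ne_eight (A : Set X) : pattern A &&& 24 ≠ 8 := by
  intro h
  have h₃ : (pattern A &&& 24).testBit 3 = true := by rw [h]; decide
  have h₄ : (pattern A &&& 24).testBit 4 = false := by rw [h]; decide
  simp only [Nat.testBit_and] at h₃ h₄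
  rw [show Nat.testBit 24 3 = true by decide, Bool.and_true] at h₃
  rw [show Nat.testBit 24 4 = true by decide, Bool.and_true] at h₄
  obtain ⟨x, hx⟩ := (pattern_testBit A 3).1 h₃
  have : x ∈ closure (interior (frontier A)) := (hx .bi_f).2 (by decide)
  exact absurd ((pattern_testBit A 4).2 (exists_inCell_four this)) (ne_true_of_eq_false h₄)

theorem pattern_testBit_of_cellNeeds (A : Set X) (j k : Fin 16)
    (hk : (cellNeeds.getD j 0).testBit k = true) (hj : (pattern A).testBit j = true) :
    (pattern A).testBit k = true := by
  -- Every listed need is an instance of one of six topological implications.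
  have key : ∀ j k : Fin 16, (cellNeeds.getD j 0).testBit k = true →
      (k = 0 ∧ EvenOp.bi.cellMask.testBit j = true) ∨
      (k = 1 ∧ EvenOp.ibi.cellMask.testBit j = true ∧ ¬EvenOp.i.cellMask.testBit j = true) ∨
      (k = 3 ∧ EvenOp.bi_f.cellMask.testBit j = true) ∨
      (k = 4 ∧ EvenOp.bi_f.cellMask.testBit j = true) ∨
      (k = 5 ∧ ¬EvenOp.ib.cellMask.testBit j = true) ∨
      (k = 14 ∧ EvenOp.b.cellMask.testBit j = true ∧
        ¬EvenOp.bib.cellMask.testBit j = true) := by decide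
  obtain ⟨x, hx⟩ := (pattern_testBit A j).1 hj
  rw [pattern_testBit]
  have h := key j k hk
  simp only [← hx _] at h
  rcases h with ⟨rfl, h⟩ | ⟨rfl, h, h'⟩ | ⟨rfl, h⟩ | ⟨rfl, h⟩ | ⟨rfl, h⟩ | ⟨rfl, h, h'⟩
  · exact exists_inCell_zero h
  · exact exists_inCell_one h h'
  · exact exists_inCell_three h
  · exact exists_inCell_four h
  · exact exists_inCell_five h
  · exact exists_inCell_fourteen h h'

theorem pattern_mod_and_cellNeeds (A : Set X) (j m : ℕ) (hm : cellNeeds[j]? = some m)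
    (hj : (pattern A).testBit j = true) : pattern A % 2 ^ j &&& m = m := by
  have hj16 := lt_of_pattern_testBit hj
  -- Needs lie below `j`, so truncation at `j` does not lose them.
  have hlt : ∀ j : Fin 16, cellNeeds.getD j 0 < 2 ^ (j : ℕ) := by decide
  have hm' : cellNeeds.getD j 0 = m := by rw [List.getD_eq_getElem?_getD, hm]; rfl
  have hmlt : m < 2 ^ j := hm' ▸ hlt ⟨j, hj16⟩
  apply Nat.eq_of_testBit_eq
  intro k
  rw [Nat.testBit_and, Nat.testBit_mod_two_pow]
  cases hk : m.testBit k
  · simp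
  · have hkj : k < j := by
      by_contra hkj
      have := Nat.testBit_lt_two_pow (hmlt.trans_le (Nat.pow_le_pow_right (by norm_num) (not_lt.1 hkj)))
      simp [this] at hk
    have := pattern_testBit_of_cellNeeds A ⟨j, hj16⟩ ⟨k, hkj.trans hj16⟩ (by simp only [hm', hk]) hj
    simp [hkj, this]

theorem mem_act_iff_of_inCell {k : Fin 16} (h : InCell A x k) (o : KF) :
    x ∈ o.act A ↔ o.cellMask.testBit k = true := by
  rcases o with o | o
  · exact h o
  · change x ∉ o.act A ↔ (65535 ^^^ o.cellMask).testBit k = true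
    have : ∀ k : Fin 16, Nat.testBit 65535 k = true := by decide
    rw [h o, Nat.testBit_xor, this, Bool.true_xor, Bool.not_eq_true', Bool.not_eq_true]

theorem act_eq_act_iff (A : Set X) (o₁ o₂ : KF) :
    o₁.act A = o₂.act A ↔ pattern A &&& o₁.cellMask = pattern A &&& o₂.cellMask := by
  constructor
  · intro h
    apply Nat.eq_of_testBit_eq
    intro k
    rw [Nat.testBit_and, Nat.testBit_and]
    cases hk : (pattern A).testBit k
    · simp
    · obtain ⟨x, hx⟩ := (pattern_testBit A ⟨k, lt_of_pattern_testBit hk⟩).1 hk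
      rw [Bool.true_and, Bool.true_and, Bool.eq_iff_iff, ← mem_act_iff_of_inCell hx,
        ← mem_act_iff_of_inCell hx, h]
  · intro h
    ext x
    obtain ⟨k, hk⟩ := exists_inCell A x
    have hP := (pattern_testBit A k).2 ⟨x, hk⟩
    have := congrArg (Nat.testBit · k) h
    simp only [Nat.testBit_and, hP, Bool.true_and] at this
    rw [mem_act_iff_of_inCell hk, mem_act_iff_of_inCell hk, this]

/-- Every subset of a nonempty space satisfies the collapse of a row of the table. -/
theorem exists_row_satisfiesCollapse [Nonempty X] (A : Set X) :
    ∃ n ∈ Set.Icc 1 70, SatisfiesCollapse A (tableCollapse n) := by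
  obtain ⟨n, hn, h⟩ := exists_row_of_pattern (pattern_lt A) (pattern_ne_zero A)
    (pattern_and_ne_eight A) (pattern_mod_and_cellNeeds A)
  refine ⟨n + 1, ⟨by omega, by omega⟩, fun o₁ o₂ => ?_⟩
  rw [act_eq_act_iff, land_eq_land_iff_of_patternCode_eq h, mem_tableCollapse]
  exact eq_iff_chainsRel_of_chainsMatch
    (List.all_eq_true.1 rowPatterns_match n (List.mem_range.2 hn)) o₁ o₂

end Cells

theorem collapse_eq_of_satisfiesCollapse {X : Type*} [TopologicalSpace X] {A : Set X}
    {C D : Collapse} (hC : SatisfiesCollapse A C) (hD : SatisfiesCollapse A D) : C = D := by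
  ext p
  induction p with | _ o₁ o₂ => rw [← hC, ← hD]

/-! ### Witness sets in the sum of four copies -/

theorem foldr_range'_testBit (f : ℕ → Bool) (s n i : ℕ) :
    ((List.range' s n).foldr (fun x c => Nat.add (Nat.mul 2 c) (f x).toNat) 0).testBit i =
      (decide (i < n) && f (s + i)) := by
  induction n generalizing s i with
  | zero => simp
  | succ n ih =>
    rw [List.range'_succ, List.foldr_cons, Nat.add_eq, Nat.mul_eq, ← Nat.bit_val]
    cases i with
    | zero => simp
    | succ i =>
      rw [Nat.testBit_bit_succ, ih]
      simp [add_assoc, add_comm 1]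

theorem foldr_lt_two_pow (f : ℕ → Bool) (l : List ℕ) :
    l.foldr (fun x c => Nat.add (Nat.mul 2 c) (f x).toNat) 0 < 2 ^ l.length := by
  induction l with
  | nil => simp
  | cons x l ih =>
    have := Bool.toNat_lt (f x)
    rw [List.foldr_cons, List.length_cons, Nat.add_eq, Nat.mul_eq, pow_succ]
    omega

/-- A space with eleven points, in which the minimal neighbourhoods are given by `nhdMask`. -/
def ClusterSpace : Type := Fin 11

namespace ClusterSpace

def val (x : ClusterSpace) : ℕ := Fin.val x

theorem val_lt (x : ClusterSpace) : x.val < 11 := Fin.isLt x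

def ofLt (k : ℕ) (h : k < 11) : ClusterSpace := Fin.mk k h

instance : TopologicalSpace ClusterSpace where
  IsOpen s := ∀ x ∈ s, ∀ y : ClusterSpace, (nhdMask x.val).testBit y.val = true → y ∈ s
  isOpen_univ := fun _ _ _ _ => trivial
  isOpen_inter := fun _ _ hs ht x hx y hy => ⟨hs x hx.1 y hy, ht x hx.2 y hy⟩
  isOpen_sUnion := fun _ h x ⟨s, hs, hx⟩ y hy => ⟨s, hs, h s hs x hx y hy⟩

theorem isOpen_iff (s : Set ClusterSpace) :
    IsOpen s ↔ ∀ x ∈ s, ∀ y : ClusterSpace, (nhdMask x.val).testBit y.val = true → y ∈ s := Iff.rfl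

theorem nhdMask_self (x : ClusterSpace) : (nhdMask x.val).testBit x.val = true := by
  have : ∀ x : Fin 11, (nhdMask x).testBit x = true := by decide
  exact this x

/-- Transitivity makes the minimal neighbourhoods open. -/
theorem nhdMask_trans (x y z : ClusterSpace) (h : (nhdMask x.val).testBit y.val = true)
    (h' : (nhdMask y.val).testBit z.val = true) : (nhdMask x.val).testBit z.val = true := by
  have : ∀ x y z : Fin 11, (nhdMask x).testBit y = true → (nhdMask y).testBit z = true →
    (nhdMask x).testBit z = true := by decide +kernel
  exact this x y z h h'

theorem card_eq : Nat.card ClusterSpace = 11 := Nat.card_fin 11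

/-- The sum of four copies. -/
abbrev FourSum : Type := Σ _ : Fin 4, ClusterSpace

theorem mem_closure_iff_exists (s : Set FourSum) (p : FourSum) :
    p ∈ closure s ↔ ∃ y : ClusterSpace, (nhdMask p.2.val).testBit y.val = true ∧
      (⟨p.1, y⟩ : FourSum) ∈ s := by
  rw [mem_closure_iff]
  constructor
  · intro h
    obtain ⟨⟨j, y⟩, ⟨hj, hy⟩, hs⟩ := h
      {q | q.1 = p.1 ∧ (nhdMask p.2.val).testBit q.2.val = true}
      (isOpen_sigma_iff.2 fun i => (isOpen_iff _).2 fun x hx y hy =>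
        ⟨hx.1, nhdMask_trans _ _ _ hx.2 hy⟩)
      ⟨rfl, nhdMask_self _⟩
    obtain rfl : j = p.1 := hj
    exact ⟨y, hy, hs⟩
  · rintro ⟨y, hy, hs⟩ o ho hp
    exact ⟨_, (isOpen_iff _).1 (isOpen_sigma_iff.1 ho p.1) p.2 hp y hy, hs⟩

/-- The position of a point in bit masks. -/
def index (p : FourSum) : ℕ := 11 * p.1 + p.2.val

theorem index_lt (p : FourSum) : index p < 44 := by
  have h₁ := p.1.isLt
  have h₂ := p.2.val_lt
  rw [index]; omega

/-- The set with a given bit mask. -/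
def ofMask (B : ℕ) : Set FourSum := {p | B.testBit (index p) = true}

theorem exists_index_eq {k : ℕ} (hk : k < 44) : ∃ p, index p = k :=
  ⟨⟨⟨k / 11, by omega⟩, ofLt (k % 11) (by omega)⟩, Nat.div_add_mod k 11⟩

theorem ofMask_inj {B C : ℕ} (hB : B < 2 ^ 44) (hC : C < 2 ^ 44) : ofMask B = ofMask C ↔ B = C := by
  refine ⟨fun h => Nat.eq_of_testBit_eq fun k => ?_, fun h => h ▸ rfl⟩
  by_cases hk : k < 44
  · obtain ⟨p, rfl⟩ := exists_index_eq hk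
    exact Bool.eq_iff_iff.2 (Set.ext_iff.1 h p)
  · have hle : 2 ^ 44 ≤ 2 ^ k := Nat.pow_le_pow_right (by norm_num) (not_lt.1 hk)
    rw [Nat.testBit_lt_two_pow (hB.trans_le hle), Nat.testBit_lt_two_pow (hC.trans_le hle)]

theorem nhdMask_lt (k : ℕ) : nhdMask k < 2 ^ 11 := by
  unfold nhdMask; split <;> norm_num

theorem closure_ofMask (B : ℕ) : closure (ofMask B) = ofMask (clMask B) := by
  ext p
  have h₂ := p.2.val_lt
  have hmod : index p % 11 = p.2.val := by rw [index]; omega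
  have hdiv : index p / 11 = p.1 := by rw [index]; omega
  rw [mem_closure_iff_exists]
  simp only [ofMask, Set.mem_ofPred_eq, clMask, List.range_eq_range', foldr_range'_testBit,
    index_lt, decide_true, Bool.true_and, zero_add, hmod, hdiv, Bool.not_eq_true',
    ← Bool.not_eq_true, Nat.beq_eq]
  constructor
  · rintro ⟨y, hy, hB⟩ h
    have := congrArg (Nat.testBit · (11 * p.1 + y.val)) h
    change (B &&& (nhdMask p.2.val <<< (11 * p.1.val))).testBit _ = Nat.testBit 0 _ at this
    rw [Nat.testBit_and, Nat.testBit_shiftLeft, Nat.add_sub_cancel_left, hy, Nat.zero_testBit] at this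
    rw [index] at hB
    simp [hB] at this
  · intro h
    obtain ⟨i, hi⟩ := Nat.exists_testBit_of_ne_zero h
    change (B &&& (nhdMask p.2.val <<< (11 * p.1.val))).testBit _ = true at hi
    rw [Nat.testBit_and, Nat.testBit_shiftLeft, Bool.and_eq_true, Bool.and_eq_true,
      decide_eq_true_iff] at hi
    obtain ⟨hB, hle, hy⟩ := hi
    -- Neighbourhood masks have eleven bits, so the common point stays in the summand of `p`.
    have hlt : i - 11 * p.1 < 11 := by
      by_contra hge
      rw [Nat.testBit_lt_two_pow ((nhdMask_lt _).trans_le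
        (Nat.pow_le_pow_right (by norm_num) (not_lt.1 hge)))] at hy
      simp at hy
    refine ⟨ofLt _ hlt, hy, ?_⟩
    have : index ⟨p.1, ofLt _ hlt⟩ = i := Nat.add_sub_cancel' hle
    rw [this]
    exact hB

theorem compl_ofMask (B : ℕ) : (ofMask B)ᶜ = ofMask (coMask B) := by
  ext p
  -- The constant in `coMask` is 2^44 - 1, the mask of the whole space.
  change ¬B.testBit (index p) = true ↔ ((2 ^ 44 - 1) ^^^ B).testBit (index p) = true
  rw [Nat.testBit_xor, Nat.testBit_two_pow_sub_one, decide_eq_true (index_lt p), Bool.true_xor,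
    Bool.not_eq_true', Bool.not_eq_true]

theorem interior_ofMask (B : ℕ) : interior (ofMask B) = ofMask (intMask B) := by
  rw [interior_eq_compl_closure_compl, compl_ofMask, closure_ofMask, compl_ofMask]; rfl

theorem frontier_ofMask (B : ℕ) : frontier (ofMask B) = ofMask (frMask B) := by
  rw [frontier_eq_closure_inter_closure, compl_ofMask, closure_ofMask, closure_ofMask]
  ext p
  change _ ↔ (clMask B &&& clMask (coMask B)).testBit (index p) = true
  rw [Nat.testBit_and, Bool.and_eq_true]; rfl

theorem act_ofMask (o : EvenOp) (B : ℕ) : o.act (ofMask B) = ofMask (o.actMask B) := by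
  cases o <;>
    simp only [EvenOp.act, EvenOp.actMask, closure_ofMask, interior_ofMask, frontier_ofMask]
  ext p
  simp [ofMask]

theorem clMask_lt (B : ℕ) : clMask B < 2 ^ 44 := by
  have := foldr_lt_two_pow (fun x => !Nat.beq (Nat.land B
    (Nat.shiftLeft (nhdMask (x % 11)) (11 * (x / 11)))) 0) (List.range 44)
  rw [List.length_range] at this
  exact this

theorem coMask_lt {B : ℕ} (hB : B < 2 ^ 44) : coMask B < 2 ^ 44 :=
  Nat.xor_lt_two_pow (by norm_num) hB

theorem intMask_lt (B : ℕ) : intMask B < 2 ^ 44 := coMask_lt (clMask_lt _)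

theorem frMask_lt (B : ℕ) : frMask B < 2 ^ 44 := Nat.and_lt_two_pow _ (clMask_lt _)

theorem actMask_lt (o : EvenOp) {B : ℕ} (hB : B < 2 ^ 44) : o.actMask B < 2 ^ 44 := by
  cases o <;> first
    | exact hB | exact clMask_lt _ | exact intMask_lt _ | exact frMask_lt _ | exact Nat.two_pow_pos 44

theorem act_eq_act_ofMask_iff {B : ℕ} (hB : B < 2 ^ 44) (o₁ o₂ : KF) :
    o₁.act (ofMask B) = o₂.act (ofMask B) ↔
      KF.value 17592186044415 (fun o => o.actMask B) o₁ =
        KF.value 17592186044415 (fun o => o.actMask B) o₂ := by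
  have key : ∀ o : KF, o.act (ofMask B) =
      ofMask (KF.value 17592186044415 (fun o => o.actMask B) o) ∧
        KF.value 17592186044415 (fun o => o.actMask B) o < 2 ^ 44 := by
    rintro (o | o)
    · exact ⟨act_ofMask o B, actMask_lt o hB⟩
    · exact ⟨(congrArg compl (act_ofMask o B)).trans (compl_ofMask _), coMask_lt (actMask_lt o hB)⟩
  rw [(key o₁).1, (key o₂).1, ofMask_inj (key o₁).2 (key o₂).2]

theorem satisfiesCollapse_rowWitnesses {n : ℕ} (hn : n ∈ Set.Icc 1 70) :
    SatisfiesCollapse (ofMask (rowWitnesses.getD (n - 1) 0)) (tableCollapse n) := by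
  -- Rows are numbered from 1, list positions from 0.
  obtain ⟨n, rfl⟩ := Nat.exists_eq_add_of_le' hn.1
  have hn' : n ∈ List.range 70 := List.mem_range.2 (by have := hn.2; omega)
  have hlt : ((List.range 70).all fun n => Nat.blt (rowWitnesses.getD n 0) (2 ^ 44)) = true := by
    decide +kernel
  rw [Nat.add_sub_cancel]
  intro o₁ o₂
  have hlt' := List.all_eq_true.1 hlt n hn'
  rw [Nat.blt_eq] at hlt'
  rw [act_eq_act_ofMask_iff hlt', mem_tableCollapse]
  exact eq_iff_chainsRel_of_chainsMatch (List.all_eq_true.1 rowWitnesses_match n hn') o₁ o₂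

end ClusterSpace

/-! ### Transfer between universes, distinctness and the count -/

/-- Needed to lift the witness space to an arbitrary universe. -/
theorem SatisfiesCollapse.preimage {X Y : Type*} [TopologicalSpace X] [TopologicalSpace Y]
    (e : X ≃ₜ Y) {A : Set Y} {C : Collapse} (h : SatisfiesCollapse A C) :
    SatisfiesCollapse (e ⁻¹' A) C := by
  have even : ∀ o : EvenOp, o.act (e ⁻¹' A) = e ⁻¹' o.act A := by
    intro o
    cases o <;> simp only [EvenOp.act, e.preimage_closure, e.preimage_interior,
      e.preimage_frontier, Set.preimage_empty]
  have key : ∀ o : KF, o.act (e ⁻¹' A) = e ⁻¹' o.act A := by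
    rintro (o | o)
    · exact even o
    · exact congrArg compl (even o)
  intro o₁ o₂
  rw [key, key, e.surjective.preimage_injective.eq_iff]
  exact h o₁ o₂

theorem isLocalCollapse_tableCollapse {n : ℕ} (hn : n ∈ Set.Icc 1 70) :
    IsLocalCollapse.{u} (tableCollapse n) :=
  ⟨ULift.{u} ClusterSpace.FourSum, inferInstance, ⟨⟨⟨0, ClusterSpace.ofLt 0 (by norm_num)⟩⟩⟩, _,
    (ClusterSpace.satisfiesCollapse_rowWitnesses hn).preimage Homeomorph.ulift⟩

set_option maxRecDepth 100000 in
-- `cellDiffs` has no superfluous entry: each is tested by an actual equation, so equal collapses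
-- force equal codes.
theorem exists_xor_cellMask_eq {d : ℕ} (hd : d ∈ cellDiffs) :
    ∃ o₁ o₂ : KF, o₁.cellMask ^^^ o₂.cellMask = d := by
  have h : (cellDiffs.all fun d => KF.list.any fun o₁ => KF.list.any fun o₂ =>
      Nat.beq (Nat.xor o₁.cellMask o₂.cellMask) d) = true := by decide +kernel
  obtain ⟨o₁, -, h⟩ := List.any_eq_true.1 (List.all_eq_true.1 h d hd)
  obtain ⟨o₂, -, h⟩ := List.any_eq_true.1 h
  exact ⟨o₁, o₂, Nat.eq_of_beq_eq_true h⟩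

theorem patternCode_eq_of_land_eq_land_iff {P Q : ℕ}
    (h : ∀ o₁ o₂ : KF, P &&& o₁.cellMask = P &&& o₂.cellMask ↔
      Q &&& o₁.cellMask = Q &&& o₂.cellMask) : patternCode P = patternCode Q := by
  apply List.foldr_ext
  intro d hd c
  obtain ⟨o₁, o₂, rfl⟩ := exists_xor_cellMask_eq hd
  have h := h o₁ o₂
  rw [land_eq_land_iff, land_eq_land_iff] at h
  have e : Nat.beq (Nat.land P (o₁.cellMask ^^^ o₂.cellMask)) 0 =
      Nat.beq (Nat.land Q (o₁.cellMask ^^^ o₂.cellMask)) 0 := by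
    rw [Bool.eq_iff_iff, Nat.beq_eq, Nat.beq_eq]
    exact h
  rw [e]

theorem injOn_tableCollapse : Set.InjOn tableCollapse (Set.Icc 1 70) := by
  intro n hn m hm h
  obtain ⟨n, rfl⟩ := Nat.exists_eq_add_of_le' hn.1
  obtain ⟨m, rfl⟩ := Nat.exists_eq_add_of_le' hm.1
  have hn' : n < 70 := by have := hn.2; omega
  have hm' : m < 70 := by have := hm.2; omega
  have row : ∀ n < 70, ∀ o₁ o₂ : KF,
      rowPatterns.getD n 0 &&& o₁.cellMask = rowPatterns.getD n 0 &&& o₂.cellMask ↔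
        s(o₁, o₂) ∈ tableCollapse (n + 1) := by
    intro n hn o₁ o₂
    rw [mem_tableCollapse]
    exact eq_iff_chainsRel_of_chainsMatch
      (List.all_eq_true.1 rowPatterns_match n (List.mem_range.2 hn)) o₁ o₂
  have hcode := patternCode_eq_of_land_eq_land_iff (P := rowPatterns.getD n 0)
    (Q := rowPatterns.getD m 0) fun o₁ o₂ => by rw [row n hn', row m hm', h]
  have hlen : rowCodes.length = 70 := by simp [rowCodes, rowPatterns]
  have get : ∀ n (hn : n < rowCodes.length), rowCodes[n] = patternCode (rowPatterns.getD n 0) := by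
    intro n hn
    have hn₂ : n < rowPatterns.length := by simpa [rowCodes] using hn
    simp only [rowCodes, List.getElem_map, List.getD_eq_getElem _ _ hn₂]
  rw [← get n (hlen ▸ hn'), ← get m (hlen ▸ hm'), nodup_rowCodes.getElem_inj_iff] at hcode
  rw [hcode]

theorem bijOn_tableCollapse :
    Set.BijOn tableCollapse (Set.Icc 1 70) {C : Collapse | IsLocalCollapse.{u} C} := by
  refine ⟨fun n hn => isLocalCollapse_tableCollapse hn, injOn_tableCollapse, ?_⟩
  rintro C ⟨X, _, _, A, hA⟩
  obtain ⟨n, hn, h⟩ := exists_row_satisfiesCollapse A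
  exact ⟨n, hn, collapse_eq_of_satisfiesCollapse h hA⟩

theorem mainTheorem2 :
    {C : Collapse | IsLocalCollapse.{u} C}.ncard = 70 ∧
    Set.BijOn tableCollapse (Set.Icc 1 70) {C : Collapse | IsLocalCollapse.{u} C} ∧
    ∃ (Y : Fin 4 → Type) (_ : ∀ j, TopologicalSpace (Y j)),
      (∀ j, Nat.card (Y j) = 11) ∧
      ∀ n ∈ Set.Icc 1 70, ∃ A : Set (Σ j, Y j), SatisfiesCollapse A (tableCollapse n) := by
  refine ⟨?_, bijOn_tableCollapse, fun _ => ClusterSpace, fun _ => inferInstance,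
    fun _ => ClusterSpace.card_eq,
    fun n hn => ⟨_, ClusterSpace.satisfiesCollapse_rowWitnesses hn⟩⟩
  rw [← bijOn_tableCollapse.image_eq, injOn_tableCollapse.ncard_image]
  simp [Set.ncard_eq_toFinset_card']
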